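/- **Theorem.** A *random walk labeling* of a finite connected simple graph $G$ is a labeling of all its vertices obtainable as follows: choose a vertex $v$, label it $1$ and set $i=1$; as long as some vertex is unlabeled, choose a neighbour $w$ of the current vertex $v$ and move to it (replace $v$ by $w$), and if the new current vertex is unlabeled, increase $i$ by $1$ and label it $i$. Let $\mathcal{L}(G)$ be the number of random walk labelings of $G$. For integers $a_1,a_2,a_3\ge 2$ let $S_{a_1,a_2,a_3}$ be the graph on $a_1+a_2+a_3$ vertices consisting of three disjoint paths $P_{a_1},P_{a_2},P_{a_3}$, with $a_1$, $a_2$, $a_3$ vertices respectively, together with four further edges: the first vertex of $P_{a_2}$ is joined to the first vertex of $P_{a_1}$ and to the first vertex of $P_{a_3}$, and the last vertex of $P_{a_2}$ is joined to the last vertex of $P_{a_1}$ and to the last vertex of $P_{a_3}$. Let $$F(x,y,z)=\sum_{a_1,a_2,a_3\ge 2}\mathcal{L}(S_{a_1,a_2,a_3})\,x^{a_1}y^{a_2}z^{a_3}\in\mathbb{Q}[[x,y,z]].$$ Then, as formal power series (the denominator has constant term $1$, hence is invertible), $$F(x,y,z)=\frac{16x^2y^2z^2f(x,y,z)}{(1-2x)^3(1-2y)^3(1-2z)^3(1-2x-2y)(1-2x-2z)(1-2y-2z)(1-x-y-z)},$$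 where $$\begin{aligned} f(x,y,z)={}&13+360y^4-96y+292y^2-456y^3-112y^5\\ &+8(56y^3-100y^2+64y-15)(x^5+z^5)\\ &-4(480y^5-2056y^4+3336y^3-2690y^2+1103y-185)xz\\ &+4xz(672y^5-3544y^4+6756y^3-6238y^2+2885y-541)(x+z)\\ &-8xz(160y^5-1304y^4+3204y^3-3520y^2+1864y-393)(x^2+z^2)\\ &-8(384y^5-2592y^4+5960y^3-6436y^2+3418y-727)x^2z^2\\ &-8xz(320y^4-1320y^3+1868y^2-1168y+281)(x^3+z^3)\\ &+16x^2z^2(64y^5-752y^4+2360y^3-3140y^2+1955y-475)(x+z)\\ &-16xz(80y^3-176y^2+138y-39)(x^4+z^4)\\ &+64x^2z^2(32y^4-190y^3+345y^2-262y+74)(x^2+z^2)\\ &+32(128y^4-696y^3+1244y^2-944y+267)x^3z^3\\ &+64x^2z^2(16y^3-50y^2+50y-17)(x^3+z^3)\\ &+128x^3z^3(32y^3-99y^2+98y-33)(x+z)\\ &+128x^3z^3(8y^2-12y+5)(x+z)^2\\ &+(496y^5-1824y^4+2596y^3-1852y^2+675y-101)(x+z)\\ &-4(200y^5-892y^4+1470y^3-1183y^2+479y-79)(x^2+z^2)\\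 &+4(112y^5-760y^4+1584y^3-1490y^2+679y-124)(x^3+z^3)\\ &+4(224y^4-760y^3+900y^2-474y+97)(x^4+z^4). \end{aligned}$$ -/

import Mathlib

/-- The configurations that can occur while a random walk labels the vertices of `G`.
`RandomWalkState G v i ℓ` says that the walk can be at the vertex `v`, the last label used being `i`
and the labels assigned so far being given by `ℓ`, where `ℓ u = 0` means that `u` is not labeled
(the labels are `1, 2, 3, …`). -/
inductive RandomWalkState {V : Type*} [DecidableEq V] (G : SimpleGraph V) :
    V → ℕ → (V → ℕ) → Prop
  /-- Choose a starting vertex and label it with `1`. -/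
  | start (v : V) : RandomWalkState G v 1 (Pi.single v 1)
  /-- While some vertex is not labeled, the walk may move to a neighbour that is labeled;
  nothing else changes. -/
  | revisit {v w : V} {i : ℕ} {ℓ : V → ℕ} (h : RandomWalkState G v i ℓ)
      (hne : ∃ u, ℓ u = 0) (hvw : G.Adj v w) (hw : ℓ w ≠ 0) : RandomWalkState G w i ℓ
  /-- The walk may move to a neighbour that is not labeled; it receives the next label. -/
  | visit {v w : V} {i : ℕ} {ℓ : V → ℕ} (h : RandomWalkState G v i ℓ)
      (hvw : G.Adj v w) (hw : ℓ w = 0) :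
      RandomWalkState G w (i + 1) (Function.update ℓ w (i + 1))

/-- A random walk labeling of `G`: a labeling of all the vertices that some random walk on `G` can
produce. -/
def IsRandomWalkLabeling {V : Type*} [DecidableEq V] (G : SimpleGraph V) (ℓ : V → ℕ) : Prop :=
  (∃ v i, RandomWalkState G v i ℓ) ∧ ∀ u, ℓ u ≠ 0

/-- The number `𝓛(G)` of random walk labelings of `G`. -/
noncomputable def numRandomWalkLabelings {V : Type*} [DecidableEq V] (G : SimpleGraph V) : ℕ :=
  Set.ncard {ℓ : V → ℕ | IsRandomWalkLabeling G ℓ}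

/-- The edges of `S_{a₁,a₂,a₃}`, each listed in one direction. The three summands of the vertex type
are the vertices of the paths `P_{a₁}`, `P_{a₂}` (the middle one) and `P_{a₃}`. -/
def threePathsRel (a₁ a₂ a₃ : ℕ) :
    Fin a₁ ⊕ Fin a₂ ⊕ Fin a₃ → Fin a₁ ⊕ Fin a₂ ⊕ Fin a₃ → Prop
  -- consecutive vertices of each of the three paths
  | .inl i, .inl j => i.val + 1 = j.val
  | .inr (.inl i), .inr (.inl j) => i.val + 1 = j.val
  | .inr (.inr i), .inr (.inr j) => i.val + 1 = j.val
  -- first vertex to first vertex and last to last, between an outer path and the middle path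
  | .inl i, .inr (.inl j) => (i.val = 0 ∧ j.val = 0) ∨ (i.val + 1 = a₁ ∧ j.val + 1 = a₂)
  | .inr (.inr i), .inr (.inl j) => (i.val = 0 ∧ j.val = 0) ∨ (i.val + 1 = a₃ ∧ j.val + 1 = a₂)
  | _, _ => False

/-- The graph `S_{a₁,a₂,a₃}`: the three paths `P_{a₁}`, `P_{a₂}`, `P_{a₃}`, where the two end
vertices of the first and of the third path are joined to the corresponding end vertices of the
second path, so that two cycles are formed. -/
def threePathsGraph (a₁ a₂ a₃ : ℕ) : SimpleGraph (Fin a₁ ⊕ Fin a₂ ⊕ Fin a₃) :=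
  SimpleGraph.fromRel (threePathsRel a₁ a₂ a₃)

/-- The formal power series `∑_{a₁,a₂,a₃ ≥ 2} 𝓛(S_{a₁,a₂,a₃}) x^{a₁} y^{a₂} z^{a₃}`, the variables
`x`, `y`, `z` being indexed by `0`, `1`, `2`. -/
noncomputable def threePathsGenFun : MvPowerSeries (Fin 3) ℚ :=
  fun a => if 2 ≤ a 0 ∧ 2 ≤ a 1 ∧ 2 ≤ a 2 then
    (numRandomWalkLabelings (threePathsGraph (a 0) (a 1) (a 2)) : ℚ) else 0

/-- The polynomial `f(x,y,z)` in the numerator. -/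
def threePathsNumerator {R : Type*} [CommRing R] (x y z : R) : R :=
  13 + 360*y^4 - 96*y + 292*y^2 - 456*y^3 - 112*y^5
  + 8*(56*y^3 - 100*y^2 + 64*y - 15)*(x^5 + z^5)
  - 4*(480*y^5 - 2056*y^4 + 3336*y^3 - 2690*y^2 + 1103*y - 185)*x*z
  + 4*x*z*(672*y^5 - 3544*y^4 + 6756*y^3 - 6238*y^2 + 2885*y - 541)*(x + z)
  - 8*x*z*(160*y^5 - 1304*y^4 + 3204*y^3 - 3520*y^2 + 1864*y - 393)*(x^2 + z^2)
  - 8*(384*y^5 - 2592*y^4 + 5960*y^3 - 6436*y^2 + 3418*y - 727)*x^2*z^2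
  - 8*x*z*(320*y^4 - 1320*y^3 + 1868*y^2 - 1168*y + 281)*(x^3 + z^3)
  + 16*x^2*z^2*(64*y^5 - 752*y^4 + 2360*y^3 - 3140*y^2 + 1955*y - 475)*(x + z)
  - 16*x*z*(80*y^3 - 176*y^2 + 138*y - 39)*(x^4 + z^4)
  + 64*x^2*z^2*(32*y^4 - 190*y^3 + 345*y^2 - 262*y + 74)*(x^2 + z^2)
  + 32*(128*y^4 - 696*y^3 + 1244*y^2 - 944*y + 267)*x^3*z^3
  + 64*x^2*z^2*(16*y^3 - 50*y^2 + 50*y - 17)*(x^3 + z^3)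
  + 128*x^3*z^3*(32*y^3 - 99*y^2 + 98*y - 33)*(x + z)
  + 128*x^3*z^3*(8*y^2 - 12*y + 5)*(x + z)^2
  + (496*y^5 - 1824*y^4 + 2596*y^3 - 1852*y^2 + 675*y - 101)*(x + z)
  - 4*(200*y^5 - 892*y^4 + 1470*y^3 - 1183*y^2 + 479*y - 79)*(x^2 + z^2)
  + 4*(112*y^5 - 760*y^4 + 1584*y^3 - 1490*y^2 + 679*y - 124)*(x^3 + z^3)
  + 4*(224*y^4 - 760*y^3 + 900*y^2 - 474*y + 97)*(x^4 + z^4)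

/-- The product of the factors in the denominator. -/
def threePathsDenominator {R : Type*} [CommRing R] (x y z : R) : R :=
  (1 - 2*x)^3 * (1 - 2*y)^3 * (1 - 2*z)^3 * (1 - 2*x - 2*y) * (1 - 2*x - 2*z) * (1 - 2*y - 2*z)
    * (1 - x - y - z)

/-! The labeled vertices always form a connected set, so the walk can return to any of them while
some vertex is unlabeled. Hence a labeling is an order of the vertices in which each one but the
first has an earlier neighbour (`isRandomWalkLabeling_iff`), and labelings are counted by growing a
set from each start vertex (`numRandomWalkLabelings_eq_sum`).

The graph $S$ is a theta graph: two branch vertices, the ends of the middle path, joined by paths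
with $a_1$, $a_2-2$, $a_3$ interior vertices. Let $p_k$ count the unlabeled interior vertices of
path $k$. If both branch vertices are labeled, the gaps shrink independently, in multinomial times
$\prod 2^{p_k-1}$ ways, the exponents truncated at $0$ (`growthCount_gaps`). If exactly one is
labeled, the set grows along a path or, when some $p_k=0$, takes the other branch vertex; this gives
$T=g/(1-x-y-z)$, where $g$ collects the gap counts with some $p_k=0$ (`growthCount_tree`). If
neither is labeled, the set is an interval inside one path $k$, and summing over its positions gives
$I_k=2T/(1-2x_k)$ (`sum_growthCount_pathInterval`). Summed over all starts, the series is $H=2T+\sum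
x_kI_k=T\,(\sum 1/(1-2x_k)-1)$.

Finally $F$ is $y^2$ times the part of $H$ whose exponents of $x$ and $z$ are at least $2$. The
discarded parts are explicit, and removing them is the identity `threePaths_rational_identity`. -/

/-- The partial fraction identity behind the generating function. -/
theorem threePaths_rational_identity {K : Type*} [Field K] [CharZero K] {x y z : K}
    (hx : 1 - 2 * x ≠ 0) (hy : 1 - 2 * y ≠ 0) (hz : 1 - 2 * z ≠ 0)
    (hxy : 1 - 2 * x - 2 * y ≠ 0) (hxz : 1 - 2 * x - 2 * z ≠ 0) (hyz : 1 - 2 * y - 2 * z ≠ 0)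
    (h : 1 - x - y - z ≠ 0) {a b c A B C W : K}
    (ha : a = 1 / (1 - 2 * x)) (hb : b = 1 / (1 - 2 * y)) (hc : c = 1 / (1 - 2 * z))
    (hA : A = 1 / (1 - 2 * x - 2 * y)) (hB : B = 1 / (1 - 2 * x - 2 * z))
    (hC : C = 1 / (1 - 2 * y - 2 * z)) (hW : W = 1 / (1 - x - y - z)) :
    (1 + A + B + C) / 4 * W * (a + b + c - 1) =
      16 * x ^ 2 * z ^ 2 * threePathsNumerator x y z / threePathsDenominator x y z
      + (C + b * c) * (b + c) / 2
      + x * (b * c * (C + b * c + b ^ 2 + c ^ 2) + C + b * c)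
      + ((A + b * a) * (b + a) / 2 - b * (b + 1) - x * (b ^ 3 + 2 * b ^ 2 + 3 * b))
      + z * ((b * a * (A + b * a + b ^ 2 + a ^ 2) + A + b * a) - (b ^ 3 + 2 * b ^ 2 + 3 * b)
        - x * (4 * b ^ 3 + 8 * b ^ 2 + 8 * b)) := by
  subst ha hb hc hA hB hC hW
  unfold threePathsDenominator threePathsNumerator
  field_simp
  ring

/-! ### Power series: setting a variable to zero. -/

open MvPowerSeries

theorem MvPowerSeries.coeff_X_mul_eq {σ R : Type*} [CommRing R] (s : σ)
    (p : σ →₀ ℕ) (φ : MvPowerSeries σ R) :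
    coeff p (X s * φ) = if p s = 0 then 0 else coeff (p - Finsupp.single s 1) φ := by
  classical
  rw [X, coeff_monomial_mul, one_mul]
  have : Finsupp.single s 1 ≤ p ↔ ¬ p s = 0 := by
    rw [Finsupp.single_le_iff]; omega
  by_cases h : p s = 0 <;> simp [this, h]

/-- The terms of a power series that do not contain the variable `i`. -/
noncomputable def MvPowerSeries.killVarFun {σ R : Type*} [CommRing R] (i : σ)
    (φ : MvPowerSeries σ R) : MvPowerSeries σ R :=
  fun p => if p i = 0 then coeff p φ else 0

theorem MvPowerSeries.coeff_killVarFun {σ R : Type*} [CommRing R] (i : σ) (p : σ →₀ ℕ)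
    (φ : MvPowerSeries σ R) :
    coeff p (killVarFun i φ) = if p i = 0 then coeff p φ else 0 := rfl

/-- The substitution of `0` for the variable `i`. -/
noncomputable def MvPowerSeries.killVar {σ R : Type*} [CommRing R] (i : σ) :
    MvPowerSeries σ R →+* MvPowerSeries σ R where
  toFun := killVarFun i
  map_one' := by
    classical
    ext p
    rw [coeff_killVarFun, coeff_one]
    by_cases h : p = 0 <;> simp [h]
  map_zero' := by ext p; simp [coeff_killVarFun]
  map_add' φ ψ := by
    ext p
    simp only [coeff_killVarFun, map_add]
    split_ifs <;> simp
  map_mul' φ ψ := by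
    classical
    ext p
    simp only [coeff_killVarFun, coeff_mul]
    by_cases h : p i = 0
    · rw [if_pos h]
      refine Finset.sum_congr rfl fun q hq => ?_
      rw [Finset.HasAntidiagonal.mem_antidiagonal] at hq
      have h2 : q.1 i + q.2 i = 0 := by rw [← Finsupp.add_apply, hq, h]
      rw [if_pos (by omega), if_pos (by omega)]
    · rw [if_neg h]
      symm
      refine Finset.sum_eq_zero fun q hq => ?_
      rw [Finset.HasAntidiagonal.mem_antidiagonal] at hq
      have h2 : q.1 i + q.2 i ≠ 0 := by rwa [← Finsupp.add_apply, hq]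
      by_cases h3 : q.1 i = 0
      · rw [if_neg (show ¬ q.2 i = 0 by omega), mul_zero]
      · rw [if_neg h3, zero_mul]

namespace MvPowerSeries

variable {σ R : Type*} [CommRing R]

theorem coeff_killVar (i : σ) (p : σ →₀ ℕ) (φ : MvPowerSeries σ R) :
    coeff p (killVar i φ) = if p i = 0 then coeff p φ else 0 := rfl

theorem killVar_X_of_ne {i j : σ} (h : j ≠ i) :
    killVar i (X j : MvPowerSeries σ R) = X j := by
  classical
  ext p
  rw [coeff_killVar, coeff_X]
  by_cases hp : p = Finsupp.single j 1
  · subst hp; simp [h]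
  · simp [hp]

theorem coeff_eq_zero_of_killVar_eq {i : σ} {φ : MvPowerSeries σ R} (h : killVar i φ = φ)
    {p : σ →₀ ℕ} (hp : p i ≠ 0) : coeff p φ = 0 := by
  rw [← h, coeff_killVar, if_neg hp]

/-- Inverses are unique and `killVar i` is a ring homomorphism, so not containing a variable passes
to inverses. -/
theorem killVar_eq_of_mul_eq_one {i : σ} {φ ψ : MvPowerSeries σ R} (h : killVar i φ = φ)
    (hm : φ * ψ = 1) : killVar i ψ = ψ := by
  have h2 : φ * killVar i ψ = 1 := by
    have := congrArg (killVar i) hm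
    rwa [map_mul, h, map_one] at this
  calc killVar i ψ = (φ * ψ) * killVar i ψ := by rw [hm, one_mul]
    _ = ψ * (φ * killVar i ψ) := by ring
    _ = ψ := by rw [h2, mul_one]

end MvPowerSeries

/-! ### Linear recurrences, words and gap fillings. -/

section Series
variable {σ : Type*} [Fintype σ]

/-- The number of words with `p k` letters `k` for each `k`. -/
noncomputable def wordCount (p : σ →₀ ℕ) : ℚ :=
  coeff p (1 - ∑ k, X k : MvPowerSeries σ ℚ)⁻¹

/-- The number of ways to fill independent intervals of lengths `p k` one element at a time, always
taking an end of what remains of some interval. -/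
noncomputable def gapCount (p : σ →₀ ℕ) : ℚ := wordCount p * ∏ k, 2 ^ (p k - 1)

/-- Multiplying by `1 - ∑ c k X k` encodes a linear recurrence for the coefficients. This and its
converse below translate between recursive counts and rational series. -/
theorem coeff_of_linear_mul {c : σ → ℚ} {φ ψ : MvPowerSeries σ ℚ}
    (h : (1 - ∑ k, C (c k) * X k) * φ = ψ) (p : σ →₀ ℕ) :
    coeff p φ =
      ∑ k, (if p k = 0 then 0 else c k * coeff (p - Finsupp.single k 1) φ) + coeff p ψ := by
  have h2 : φ = ∑ k, C (c k) * (X k * φ) + ψ := by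
    rw [← h, sub_mul, one_mul, Finset.sum_mul]
    simp only [mul_assoc]
    abel
  conv_lhs => rw [h2]
  rw [map_add, map_sum]
  congr 1
  refine Finset.sum_congr rfl fun k _ => ?_
  rw [coeff_C_mul, coeff_X_mul_eq]
  split_ifs <;> simp

theorem linear_mul_of_coeff {c : σ → ℚ} {φ ψ : MvPowerSeries σ ℚ}
    (h : ∀ p, coeff p φ =
      ∑ k, (if p k = 0 then 0 else c k * coeff (p - Finsupp.single k 1) φ) + coeff p ψ) :
    (1 - ∑ k, C (c k) * X k) * φ = ψ := by
  have h2 : φ = ∑ k, C (c k) * (X k * φ) + ψ := by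
    ext p
    rw [h p, map_add, map_sum]
    congr 1
    refine Finset.sum_congr rfl fun k _ => ?_
    rw [coeff_C_mul, coeff_X_mul_eq]
    split_ifs <;> simp
  rw [sub_mul, one_mul, Finset.sum_mul]
  simp only [mul_assoc]
  rw [sub_eq_iff_eq_add']
  exact h2

theorem wordCount_rec [DecidableEq σ] (p : σ →₀ ℕ) :
    wordCount p = ∑ k, (if p k = 0 then 0 else wordCount (p - Finsupp.single k 1))
      + if p = 0 then 1 else 0 := by
  have := coeff_of_linear_mul (c := fun _ : σ => (1 : ℚ))
    (φ := (1 - ∑ k, X k : MvPowerSeries σ ℚ)⁻¹) (ψ := 1)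
    (by simp only [map_one, one_mul]; exact MvPowerSeries.mul_inv_cancel _ (by simp)) p
  simp only [one_mul, coeff_one] at this
  unfold wordCount
  exact this

theorem wordCount_zero : wordCount (0 : σ →₀ ℕ) = 1 := by
  classical
  rw [wordCount_rec]; simp

theorem gapCount_zero : gapCount (0 : σ →₀ ℕ) = 1 := by
  simp [gapCount, wordCount_zero]

/-- Removing a letter `k` from a word lowers the product of powers of 2 by a factor 2 if `p k ≥ 2`
and leaves it alone if `p k = 1`: a gap has two ends, which coincide when its length is 1. The two
sums are the two ends. -/
theorem gapCount_rec {p : σ →₀ ℕ} (hp : p ≠ 0) :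
    gapCount p = ∑ k, (if p k = 0 then 0 else gapCount (p - Finsupp.single k 1))
      + ∑ k, (if p k ≤ 1 then 0 else gapCount (p - Finsupp.single k 1)) := by
  classical
  rw [← Finset.sum_add_distrib]
  conv_lhs => rw [gapCount, wordCount_rec, if_neg hp, add_zero, Finset.sum_mul]
  refine Finset.sum_congr rfl fun k _ => ?_
  have key : (∏ j, (2 : ℚ) ^ (p j - 1)) =
      (if p k ≤ 1 then 1 else 2) * ∏ j, 2 ^ ((p - Finsupp.single k 1 : σ →₀ ℕ) j - 1) := by
    rw [← Finset.mul_prod_erase _ _ (Finset.mem_univ k),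
      ← Finset.mul_prod_erase (Finset.univ) _ (Finset.mem_univ k), ← mul_assoc]
    congr 1
    · simp only [Finsupp.tsub_apply, Finsupp.single_eq_same]
      split_ifs with h
      · have : p k - 1 = 0 := by omega
        simp [this]
      · obtain ⟨m, hm⟩ : ∃ m, p k = m + 2 := ⟨p k - 2, by omega⟩
        simp only [hm, Nat.add_sub_cancel, show m + 2 - 1 = m + 1 by omega]
        ring
    · refine Finset.prod_congr rfl fun j hj => ?_
      rw [Finsupp.tsub_apply, Finsupp.single_eq_of_ne (Finset.ne_of_mem_erase hj)]
      simp
  rw [key]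
  by_cases h0 : p k = 0
  · simp [h0]
  · by_cases h1 : p k ≤ 1
    · simp [h0, h1, gapCount]
    · simp only [h0, h1, gapCount, if_false]
      ring

/-- The proposed coefficients satisfy the recurrence of the denominator: each letter carries a
factor 2, and letters outside `A` never occur. -/
theorem coeff_inv_one_sub_two_mul_sum [DecidableEq σ] (A : Finset σ) (p : σ →₀ ℕ) :
    coeff p (1 - ∑ k ∈ A, 2 * X k : MvPowerSeries σ ℚ)⁻¹ =
      if ∀ k ∉ A, p k = 0 then wordCount p * 2 ^ (∑ k, p k) else 0 := by
  set φ : MvPowerSeries σ ℚ :=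
    fun p => if ∀ k ∉ A, p k = 0 then wordCount p * 2 ^ (∑ k, p k) else 0 with hφ
  have hc : ∀ q, coeff q φ =
    if ∀ k ∉ A, q k = 0 then wordCount q * 2 ^ (∑ k, q k) else 0 := fun q => rfl
  have h1 : (1 - ∑ k ∈ A, 2 * X k : MvPowerSeries σ ℚ) =
      1 - ∑ k, C (if k ∈ A then (2 : ℚ) else 0) * X k := by
    congr 1
    rw [← Finset.sum_subset (Finset.subset_univ A)]
    · refine Finset.sum_congr rfl fun k hk => ?_
      rw [if_pos hk, map_ofNat]
    · intro k _ hk; simp [hk]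
  have h2 : (1 - ∑ k, C (if k ∈ A then (2 : ℚ) else 0) * X k) * φ = 1 := by
    refine linear_mul_of_coeff fun q => ?_
    rw [hc, coeff_one]
    by_cases hq : ∀ k ∉ A, q k = 0
    · rw [if_pos hq, wordCount_rec, add_mul, Finset.sum_mul]
      congr 1
      · refine Finset.sum_congr rfl fun k _ => ?_
        by_cases h0 : q k = 0
        · simp [h0]
        · have hk : k ∈ A := by by_contra hk; exact h0 (hq k hk)
          rw [if_neg h0, if_neg h0, if_pos hk, hc, if_pos]
          · have : ∑ j, q j = ∑ j, (q - Finsupp.single k 1 : σ →₀ ℕ) j + 1 := by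
              have e : q = (q - Finsupp.single k 1) + Finsupp.single k 1 :=
                (tsub_add_cancel_of_le (by rw [Finsupp.single_le_iff]; omega)).symm
              conv_lhs => rw [e]
              simp [Finset.sum_add_distrib, Finsupp.single_apply]
            rw [this, pow_succ]; ring
          · intro j hj; simp [hq j hj]
      · by_cases h0 : q = 0 <;> simp [h0]
    · rw [if_neg hq]
      have : q ≠ 0 := by rintro rfl; simp at hq
      rw [if_neg this, add_zero]
      symm
      refine Finset.sum_eq_zero fun k _ => ?_
      by_cases hk : k ∈ A
      · have hn : ¬ ∀ j ∉ A, (q - Finsupp.single k 1 : σ →₀ ℕ) j = 0 := by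
          intro hh
          apply hq
          intro j hj
          have := hh j hj
          have hne : j ≠ k := by rintro rfl; exact hj hk
          simpa [Finsupp.single_eq_of_ne hne] using this
        rw [hc, if_neg hn, mul_zero, ite_self]
      · simp [hk]
  rw [← hc, h1]
  congr 1
  rw [MvPowerSeries.inv_eq_iff_mul_eq_one (by simp)]
  rw [mul_comm]; exact h2

end Series

/-! ### The generating functions of the growth process. -/

/-- The generating function of `gapCount` restricted to the exponents with some entry `0`. -/
noncomputable def gapSeries : MvPowerSeries (Fin 3) ℚ :=
  C (1 / 4) * (1 + (1 - 2 * X 0 - 2 * X 1)⁻¹ + (1 - 2 * X 0 - 2 * X 2)⁻¹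
    + (1 - 2 * X 1 - 2 * X 2)⁻¹)

theorem coeff_inv_one_sub_pair {i j k : Fin 3} (hij : i ≠ j) (hik : i ≠ k) (hjk : j ≠ k)
    (p : Fin 3 →₀ ℕ) :
    coeff p (1 - 2 * X i - 2 * X j : MvPowerSeries (Fin 3) ℚ)⁻¹ =
      if p k = 0 then wordCount p * 2 ^ (p 0 + p 1 + p 2) else 0 := by
  have := coeff_inv_one_sub_two_mul_sum {i, j} p
  rw [Finset.sum_pair hij, ← sub_sub, Fin.sum_univ_three] at this
  rw [this]
  congr 1
  refine propext ⟨fun h => h k (by simp [hik.symm, hjk.symm]), fun h l hl => ?_⟩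
  have : l = k := by
    simp only [Finset.mem_insert, Finset.mem_singleton, not_or] at hl
    omega
  rw [this, h]

/-- If exactly one `p k` vanishes, the weight is a quarter of `2 ^ (p 0 + p 1 + p 2)` and one
inverse contributes; if exactly two vanish, it is a half and two inverses contribute; at `p = 0`
four constant terms 1 are averaged. -/
theorem coeff_gapSeries (p : Fin 3 →₀ ℕ) :
    coeff p gapSeries = if ∃ k, p k = 0 then gapCount p else 0 := by
  rw [gapSeries, coeff_C_mul, map_add, map_add, map_add,
    coeff_inv_one_sub_pair (k := 2) (by decide) (by decide) (by decide),
    coeff_inv_one_sub_pair (k := 1) (by decide) (by decide) (by decide),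
    coeff_inv_one_sub_pair (k := 0) (by decide) (by decide) (by decide), coeff_one,
    gapCount, Fin.prod_univ_three]
  have h0 : p = 0 ↔ p 0 = 0 ∧ p 1 = 0 ∧ p 2 = 0 := by
    rw [Finsupp.ext_iff, Fin.forall_fin_succ, Fin.forall_fin_succ, Fin.forall_fin_succ]
    simp
  have hE : (∃ k, p k = 0) ↔ p 0 = 0 ∨ p 1 = 0 ∨ p 2 = 0 := by
    simp [Fin.exists_fin_succ]
  simp only [hE, h0]
  by_cases hz : p = 0
  · subst hz; simp [wordCount_zero]; norm_num
  rcases hx : p 0 with _ | a <;> rcases hy : p 1 with _ | b <;> rcases hw : p 2 with _ | c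
  · exact absurd (h0.2 ⟨hx, hy, hw⟩) hz
  all_goals simp [pow_add] <;> ring

/-- The generating function of the numbers of ways to label the rest of the graph when the labeled
part is a tree that contains exactly one of the two branch vertices. -/
noncomputable def treeSeries : MvPowerSeries (Fin 3) ℚ :=
  (1 - X 0 - X 1 - X 2)⁻¹ * gapSeries

theorem coeff_treeSeries (p : Fin 3 →₀ ℕ) :
    coeff p treeSeries =
      ∑ k, (if p k = 0 then 0 else coeff (p - Finsupp.single k 1) treeSeries)
        + if ∃ k, p k = 0 then gapCount p else 0 := by
  have := coeff_of_linear_mul (c := fun _ : Fin 3 => (1 : ℚ))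
    (φ := treeSeries) (ψ := gapSeries) (by
      rw [treeSeries, ← mul_assoc]
      simp only [map_one, one_mul, Fin.sum_univ_three, ← sub_sub]
      rw [MvPowerSeries.mul_inv_cancel _ (by simp), one_mul]) p
  rw [coeff_gapSeries] at this
  simp only [one_mul] at this
  exact this

/-- The generating function of the numbers of ways to label the rest of the graph when the labeled
part is an interval of the path `k`; the exponent of `X k` counts the unlabeled vertices of this
path, and all positions of the interval are added up. -/
noncomputable def intervalSeries (k : Fin 3) : MvPowerSeries (Fin 3) ℚ :=
  (1 - 2 * X k)⁻¹ * (2 * treeSeries)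

theorem coeff_intervalSeries (k : Fin 3) (p : Fin 3 →₀ ℕ) :
    coeff p (intervalSeries k) =
      (if p k = 0 then 0 else 2 * coeff (p - Finsupp.single k 1) (intervalSeries k))
        + 2 * coeff p treeSeries := by
  have := coeff_of_linear_mul (c := fun j : Fin 3 => if j = k then (2 : ℚ) else 0)
    (φ := intervalSeries k) (ψ := C 2 * treeSeries) (by
      rw [Finset.sum_eq_single k, if_pos rfl, map_ofNat, intervalSeries, ← mul_assoc,
        MvPowerSeries.mul_inv_cancel _ (by simp), one_mul]
      · intro j _ hj; simp [hj]
      · simp) p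
  rw [coeff_C_mul] at this
  rw [this]
  congr 1
  rw [Finset.sum_eq_single k]
  · simp
  · intro j _ hj; simp [hj]
  · simp

/-- The generating function of the numbers of labelings; the exponents are the numbers of interior
vertices of the three paths between the branch vertices. -/
noncomputable def thetaSeries : MvPowerSeries (Fin 3) ℚ :=
  2 * treeSeries + ∑ k, X k * intervalSeries k

/-! ### Rational form of the total series and extraction of the coefficients. -/

section
variable {x y z : MvPowerSeries (Fin 3) ℚ}

theorem thetaSeries_rational (hx : x = X 0) (hy : y = X 1) (hz : z = X 2) :
    ∃ φ₀ φ₁ ψ₀ ψ₁ : MvPowerSeries (Fin 3) ℚ, killVar 0 φ₀ = φ₀ ∧ killVar 0 φ₁ = φ₁ ∧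
      killVar 2 ψ₀ = ψ₀ ∧ killVar 2 ψ₁ = ψ₁ ∧
      thetaSeries = 16 * x ^ 2 * z ^ 2 * threePathsNumerator x y z * (threePathsDenominator x y z)⁻¹
        + φ₀ + x * φ₁ + ψ₀ + z * ψ₁ := by
  have hcx : constantCoeff x = 0 := by rw [hx]; simp
  have hcy : constantCoeff y = 0 := by rw [hy]; simp
  have hcz : constantCoeff z = 0 := by rw [hz]; simp
  have inv (d : MvPowerSeries (Fin 3) ℚ) (hd : constantCoeff d = 1) : d * d⁻¹ = 1 :=
    MvPowerSeries.mul_inv_cancel _ (by rw [hd]; exact one_ne_zero)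
  have ha := inv (1 - 2 * x) (by simp [hcx])
  have hb := inv (1 - 2 * y) (by simp [hcy])
  have hc := inv (1 - 2 * z) (by simp [hcz])
  have hA := inv (1 - 2 * x - 2 * y) (by simp [hcx, hcy])
  have hB := inv (1 - 2 * x - 2 * z) (by simp [hcx, hcz])
  have hC := inv (1 - 2 * y - 2 * z) (by simp [hcy, hcz])
  have hW := inv (1 - x - y - z) (by simp [hcx, hcy, hcz])
  have hD := inv (threePathsDenominator x y z) (by
    simp [threePathsDenominator, hcx, hcy, hcz])
  have kx : killVar 2 x = x := by rw [hx]; exact killVar_X_of_ne (by decide)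
  have ky : killVar 2 y = y := by rw [hy]; exact killVar_X_of_ne (by decide)
  have ky' : killVar 0 y = y := by rw [hy]; exact killVar_X_of_ne (by decide)
  have kz : killVar 0 z = z := by rw [hz]; exact killVar_X_of_ne (by decide)
  have kxa := killVar_eq_of_mul_eq_one (i := 2) (by simp [kx, map_ofNat]) ha
  have kyb := killVar_eq_of_mul_eq_one (i := 2) (by simp [ky, map_ofNat]) hb
  have kyb' := killVar_eq_of_mul_eq_one (i := 0) (by simp [ky', map_ofNat]) hb
  have kzc := killVar_eq_of_mul_eq_one (i := 0) (by simp [kz, map_ofNat]) hc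
  have kA := killVar_eq_of_mul_eq_one (i := 2) (by simp [kx, ky, map_ofNat]) hA
  have kC := killVar_eq_of_mul_eq_one (i := 0) (by simp [ky', kz, map_ofNat]) hC
  have half : (2 : MvPowerSeries (Fin 3) ℚ) * C (1 / 2) = 1 := by
    rw [← map_ofNat C 2, ← map_mul]; norm_num
  have quarter : (4 : MvPowerSeries (Fin 3) ℚ) * C (1 / 4) = 1 := by
    rw [← map_ofNat C 4, ← map_mul]; norm_num
  have kh (i : Fin 3) := killVar_eq_of_mul_eq_one (i := i) (map_ofNat _ 2) half
  have hH : thetaSeries = C (1 / 4) * (1 + (1 - 2 * x - 2 * y)⁻¹ + (1 - 2 * x - 2 * z)⁻¹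
      + (1 - 2 * y - 2 * z)⁻¹) * (1 - x - y - z)⁻¹ *
      ((1 - 2 * x)⁻¹ + (1 - 2 * y)⁻¹ + (1 - 2 * z)⁻¹ - 1) := by
    rw [thetaSeries, Fin.sum_univ_three]
    simp only [intervalSeries, treeSeries, gapSeries, ← hx, ← hy, ← hz]
    generalize C (1 / 4) * (1 + (1 - 2 * x - 2 * y)⁻¹ + (1 - 2 * x - 2 * z)⁻¹
      + (1 - 2 * y - 2 * z)⁻¹) = g
    -- This is `2x / (1 - 2x) = 1 / (1 - 2x) - 1` in each variable.
    linear_combination (-(1 - x - y - z)⁻¹ * g) * (ha + hb + hc)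
  generalize (1 - 2 * x)⁻¹ = a at *
  generalize (1 - 2 * y)⁻¹ = b at *
  generalize (1 - 2 * z)⁻¹ = c at *
  generalize (1 - 2 * x - 2 * y)⁻¹ = A at *
  generalize (1 - 2 * x - 2 * z)⁻¹ = B at *
  generalize (1 - 2 * y - 2 * z)⁻¹ = E at *
  generalize (1 - x - y - z)⁻¹ = W at *
  generalize (threePathsDenominator x y z)⁻¹ = D at *
  generalize (C (1 / 2) : MvPowerSeries (Fin 3) ℚ) = h2 at *
  generalize (C (1 / 4) : MvPowerSeries (Fin 3) ℚ) = h4 at *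
  -- The first two witnesses are the coefficients of `x ^ 0` and `x ^ 1` in the total series. The
  -- last two are those of `z ^ 0` and `z ^ 1`, less their own terms of `x`-degree at most 1, which
  -- would otherwise be removed twice.
  refine ⟨h2 * (E + b * c) * (b + c), b * c * (E + b * c + b ^ 2 + c ^ 2) + E + b * c,
    h2 * (A + b * a) * (b + a) - b * (b + 1) - x * (b ^ 3 + 2 * b ^ 2 + 3 * b),
    (b * a * (A + b * a + b ^ 2 + a ^ 2) + A + b * a) - (b ^ 3 + 2 * b ^ 2 + 3 * b)
        - x * (4 * b ^ 3 + 8 * b ^ 2 + 8 * b), ?_, ?_, ?_, ?_, ?_⟩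
  · simp [kyb', kzc, kC, kh]
  · simp [kyb', kzc, kC]
  · simp [map_ofNat, kyb, kxa, kA, kx, kh]
  · simp [map_ofNat, kyb, kxa, kA, kx]
  rw [hH]
  -- The identity is one of rational functions, so it is checked in the fraction field.
  set ι := algebraMap (MvPowerSeries (Fin 3) ℚ) (FractionRing (MvPowerSeries (Fin 3) ℚ))
  have hinj : Function.Injective ι := IsFractionRing.injective _ _
  have push {d e : MvPowerSeries (Fin 3) ℚ} (h : d * e = 1) : ι d ≠ 0 ∧ ι e = 1 / ι d := by
    have h' : ι d * ι e = 1 := by rw [← map_mul, h, map_one]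
    have h0 : ι d ≠ 0 := left_ne_zero_of_mul_eq_one h'
    exact ⟨h0, by rw [eq_div_iff h0, mul_comm, h']⟩
  have : CharZero (FractionRing (MvPowerSeries (Fin 3) ℚ)) := by
    have : CharZero (MvPowerSeries (Fin 3) ℚ) := algebraRat.charZero _
    exact charZero_of_injective_algebraMap hinj
  apply hinj
  have eD : ι (threePathsDenominator x y z) = threePathsDenominator (ι x) (ι y) (ι z) := by
    simp [threePathsDenominator, map_ofNat]
  have eN : ι (threePathsNumerator x y z) = threePathsNumerator (ι x) (ι y) (ι z) := by
    simp [threePathsNumerator, map_ofNat]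
  obtain ⟨na, ea⟩ := push ha
  obtain ⟨nb, eb⟩ := push hb
  obtain ⟨nc, ec⟩ := push hc
  obtain ⟨nA, eA⟩ := push hA
  obtain ⟨nB, eB⟩ := push hB
  obtain ⟨nE, eE⟩ := push hC
  obtain ⟨nW, eW⟩ := push hW
  obtain ⟨-, eD'⟩ := push hD
  obtain ⟨-, e2⟩ := push half
  obtain ⟨-, e4⟩ := push quarter
  simp only [map_sub, map_mul, map_one, map_ofNat] at *
  have key := threePaths_rational_identity na nb nc nA nB nE nW ea eb ec eA eB eE eW
  simp only [map_add, map_sub, map_mul, map_one, map_ofNat, map_pow, eN, eD', eD, e2, e4]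
  linear_combination key

end

/-- The corrections have degree at most 1 in `X 0` or at most 1 in `X 2`, so none reaches an
exponent with both entries at least 2. -/
theorem coeff_thetaSeries_eq (p : Fin 3 →₀ ℕ) {φ₀ φ₁ ψ₀ ψ₁ φ : MvPowerSeries (Fin 3) ℚ}
    (h₀ : killVar 0 φ₀ = φ₀) (h₁ : killVar 0 φ₁ = φ₁) (h₂ : killVar 2 ψ₀ = ψ₀)
    (h₃ : killVar 2 ψ₁ = ψ₁) (h : thetaSeries = φ + φ₀ + X 0 * φ₁ + ψ₀ + X 2 * ψ₁)
    (hp0 : 2 ≤ p 0) (hp2 : 2 ≤ p 2) : coeff p thetaSeries = coeff p φ := by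
  rw [h]
  simp only [map_add, coeff_X_mul_eq]
  rw [coeff_eq_zero_of_killVar_eq h₀ (by omega), coeff_eq_zero_of_killVar_eq h₁ (by simp; omega),
    coeff_eq_zero_of_killVar_eq h₂ (by omega), coeff_eq_zero_of_killVar_eq h₃ (by simp; omega)]
  simp

theorem coeff_X_pow_two_mul (k : Fin 3) (p : Fin 3 →₀ ℕ) (φ : MvPowerSeries (Fin 3) ℚ) :
    coeff p (X k ^ 2 * φ) = if p k < 2 then 0 else coeff (p - Finsupp.single k 2) φ := by
  rw [pow_two, mul_assoc, coeff_X_mul_eq, coeff_X_mul_eq, tsub_tsub, ← Finsupp.single_add]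
  simp only [Finsupp.tsub_apply, Finsupp.single_eq_same]
  split_ifs <;> first | rfl | omega

/-- The factor `y ^ 2` accounts for the two branch vertices, which belong to the middle path but are
not interior; all three squares make the coefficients with an exponent below 2 vanish. -/
theorem threePaths_series_eq {L : (Fin 3 →₀ ℕ) → ℚ} {x y z : MvPowerSeries (Fin 3) ℚ}
    (hx : x = X 0) (hy : y = X 1) (hz : z = X 2)
    (hL : ∀ a, 2 ≤ a 0 → 2 ≤ a 1 → 2 ≤ a 2 →
      L a = coeff (a - Finsupp.single 1 2) thetaSeries)
    {F : MvPowerSeries (Fin 3) ℚ}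
    (hF : ∀ a, coeff a F = if 2 ≤ a 0 ∧ 2 ≤ a 1 ∧ 2 ≤ a 2 then L a else 0) :
    F = 16 * x ^ 2 * y ^ 2 * z ^ 2 * threePathsNumerator x y z
      * (threePathsDenominator x y z)⁻¹ := by
  obtain ⟨φ₀, φ₁, ψ₀, ψ₁, h₀, h₁, h₂, h₃, h⟩ := thetaSeries_rational hx hy hz
  set Q := threePathsNumerator x y z * (threePathsDenominator x y z)⁻¹ with hQ
  have e : 16 * x ^ 2 * y ^ 2 * z ^ 2 * threePathsNumerator x y z
      * (threePathsDenominator x y z)⁻¹ = X 1 ^ 2 * (X 0 ^ 2 * (X 2 ^ 2 * (16 * Q))) := by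
    rw [hQ, ← hx, ← hy, ← hz]; ring
  have e' : 16 * x ^ 2 * z ^ 2 * threePathsNumerator x y z
      * (threePathsDenominator x y z)⁻¹ = X 0 ^ 2 * (X 2 ^ 2 * (16 * Q)) := by
    rw [hQ, ← hx, ← hz]; ring
  rw [e', hx, hz] at h
  ext a
  rw [hF, e, coeff_X_pow_two_mul]
  split_ifs with h1 h2 h2
  · omega
  · rw [hL a h1.1 h1.2.1 h1.2.2]
    exact coeff_thetaSeries_eq _ h₀ h₁ h₂ h₃ h (by simpa using h1.1) (by simpa using h1.2.2)
  · rfl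
  · rw [coeff_X_pow_two_mul, coeff_X_pow_two_mul]
    have e0 : (a - Finsupp.single 1 2 : Fin 3 →₀ ℕ) 0 = a 0 := by simp
    have e2 : (a - Finsupp.single 1 2 - Finsupp.single 0 2 : Fin 3 →₀ ℕ) 2 = a 2 := by simp
    rw [e0, e2]
    split_ifs <;> first | rfl | omega

/-! ### Random walk labelings as growth processes. -/

section Growth
variable {V : Type*} [DecidableEq V] (G : SimpleGraph V)

/-- The pairs of a last label and a partial labeling that arise when one vertex after the other is
labeled, each of them but the first a neighbour of some labeled vertex. -/
inductive GrowthState : ℕ → (V → ℕ) → Prop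
  | start (v : V) : GrowthState 1 (Pi.single v 1)
  | step {v w : V} {i : ℕ} {ℓ : V → ℕ} (h : GrowthState i ℓ) (hv : ℓ v ≠ 0) (hvw : G.Adj v w)
      (hw : ℓ w = 0) : GrowthState (i + 1) (Function.update ℓ w (i + 1))

variable {G}

theorem RandomWalkState.growthState {v : V} {i : ℕ} {ℓ : V → ℕ} (h : RandomWalkState G v i ℓ) :
    GrowthState G i ℓ ∧ ℓ v ≠ 0 := by
  induction h with
  | start v => exact ⟨.start v, by simp⟩
  | revisit _ _ _ hw ih => exact ⟨ih.1, hw⟩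
  | visit _ hvw hw ih => exact ⟨.step ih.1 ih.2 hvw hw, by simp⟩

theorem RandomWalkState.trans {v u : V} {i : ℕ} {ℓ : V → ℕ} (h : RandomWalkState G v i ℓ)
    (hne : ∃ u, ℓ u = 0) (hu : Relation.ReflTransGen (fun a b => G.Adj a b ∧ ℓ b ≠ 0) v u) :
    RandomWalkState G u i ℓ := by
  induction hu with
  | refl => exact h
  | tail _ hbc ih => exact .revisit ih hne hbc.1 hbc.2

/-- Each new vertex is attached to a labeled one, so the labeled set stays connected. -/
theorem GrowthState.connected {i : ℕ} {ℓ : V → ℕ} (h : GrowthState G i ℓ) {a b : V}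
    (ha : ℓ a ≠ 0) (hb : ℓ b ≠ 0) :
    Relation.ReflTransGen (fun a b => G.Adj a b ∧ ℓ b ≠ 0) a b := by
  induction h generalizing a b with
  | start v =>
    have hh : ∀ c, (Pi.single v 1 : V → ℕ) c ≠ 0 → c = v := by
      intro c hc
      by_contra hcv
      exact hc (Pi.single_eq_of_ne hcv _)
    rw [hh a ha, hh b hb]
  | @step v w i ℓ h hv hvw hw ih =>
    have hmono : ∀ c, ℓ c ≠ 0 → Function.update ℓ w (i + 1) c ≠ 0 := by
      intro c hc
      rwa [Function.update_of_ne (by rintro rfl; exact hc hw)]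
    have hold : ∀ c, c ≠ w → Function.update ℓ w (i + 1) c ≠ 0 → ℓ c ≠ 0 := by
      intro c hc h
      rwa [Function.update_of_ne hc] at h
    have ih' : ∀ {a b}, ℓ a ≠ 0 → ℓ b ≠ 0 →
        Relation.ReflTransGen (fun a b => G.Adj a b ∧ Function.update ℓ w (i + 1) b ≠ 0) a b :=
      fun ha hb => Relation.ReflTransGen.mono (fun c d hcd => ⟨hcd.1, hmono d hcd.2⟩) _ _ (ih ha hb)
    have hwv : G.Adj w v ∧ Function.update ℓ w (i + 1) v ≠ 0 := ⟨hvw.symm, hmono v hv⟩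
    have hvw' : G.Adj v w ∧ Function.update ℓ w (i + 1) w ≠ 0 := ⟨hvw, by simp⟩
    by_cases haw : a = w <;> by_cases hbw : b = w
    · rw [haw, hbw]
    · rw [haw]; exact .head hwv (ih' hv (hold b hbw hb))
    · rw [hbw]; exact .tail (ih' (hold a haw ha) hv) hvw'
    · exact ih' (hold a haw ha) (hold b hbw hb)

/-- Before each new label the walk goes through labeled vertices to the required neighbour; the
vertex about to be labeled is the unlabeled one that allows these moves. -/
theorem GrowthState.randomWalkState {i : ℕ} {ℓ : V → ℕ} (h : GrowthState G i ℓ) :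
    ∃ v, ℓ v ≠ 0 ∧ RandomWalkState G v i ℓ := by
  induction h with
  | start v => exact ⟨v, by simp, .start v⟩
  | @step v w i ℓ h hv hvw hw ih =>
    obtain ⟨v', hv', hs⟩ := ih
    exact ⟨w, by simp, .visit (hs.trans ⟨w, hw⟩ (h.connected hv' hv)) hvw hw⟩

theorem isRandomWalkLabeling_iff {ℓ : V → ℕ} :
    IsRandomWalkLabeling G ℓ ↔ (∃ i, GrowthState G i ℓ) ∧ ∀ u, ℓ u ≠ 0 := by
  refine and_congr_left fun _ => ⟨?_, ?_⟩
  · rintro ⟨v, i, h⟩; exact ⟨i, h.growthState.1⟩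
  · rintro ⟨i, h⟩
    obtain ⟨v, -, hv⟩ := h.randomWalkState
    exact ⟨v, i, hv⟩

variable [Fintype V] (G)

open Classical in
/-- The labelings that arise from `ℓ`, with last label `i`, by labeling `n` further vertices. -/
noncomputable def growthCompletions : ℕ → (V → ℕ) → ℕ → Finset (V → ℕ)
  | 0, ℓ, _ => {ℓ}
  | n + 1, ℓ, i => (Finset.univ.filter fun w => ℓ w = 0 ∧ ∃ v, ℓ v ≠ 0 ∧ G.Adj v w).biUnion
      fun w => growthCompletions n (Function.update ℓ w (i + 1)) (i + 1)

open Classical in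
/-- The vertices outside `S` with a neighbour in `S`. -/
noncomputable def outerBoundary (S : Finset V) : Finset V :=
  Finset.univ.filter fun w => w ∉ S ∧ ∃ v ∈ S, G.Adj v w

/-- The number of ways to add `n` vertices to `S`, one after the other and each of them adjacent to
the set reached so far. -/
noncomputable def growthCount : ℕ → Finset V → ℕ
  | 0, _ => 1
  | n + 1, S => ∑ w ∈ outerBoundary G S, growthCount n (insert w S)

variable {G}

theorem mem_outerBoundary {S : Finset V} {w : V} :
    w ∈ outerBoundary G S ↔ w ∉ S ∧ ∃ v ∈ S, G.Adj v w := by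
  simp [outerBoundary]

/-- Old labels persist and new ones exceed `i`; this keeps the completions of different choices
apart. -/
theorem growthCompletions_spec {n i : ℕ} {ℓ ℓ' : V → ℕ} (h : ℓ' ∈ growthCompletions G n ℓ i)
    (u : V) : (ℓ u ≠ 0 → ℓ' u = ℓ u) ∧ (ℓ u = 0 → ℓ' u = 0 ∨ i < ℓ' u) := by
  induction n generalizing ℓ i with
  | zero =>
    rw [growthCompletions, Finset.mem_singleton] at h
    subst h
    exact ⟨fun _ => rfl, fun h => .inl h⟩
  | succ n ih =>
    rw [growthCompletions, Finset.mem_biUnion] at h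
    obtain ⟨w, hw, h⟩ := h
    simp only [Finset.mem_filter] at hw
    have := ih h
    by_cases huw : u = w
    · subst huw
      rw [Function.update_self] at this
      refine ⟨fun h => absurd hw.2.1 h, fun _ => .inr ?_⟩
      rw [this.1 (by omega)]; omega
    · rw [Function.update_of_ne huw] at this
      exact ⟨this.1, fun h => (this.2 h).imp id fun h => by omega⟩

theorem card_growthCompletions (n i : ℕ) (ℓ : V → ℕ) :
    (growthCompletions G n ℓ i).card = growthCount G n (Finset.univ.filter (ℓ · ≠ 0)) := by
  induction n generalizing ℓ i with
  | zero => simp [growthCompletions, growthCount]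
  | succ n ih =>
    rw [growthCompletions, growthCount, Finset.card_biUnion]
    · refine Finset.sum_congr ?_ fun w hw => ?_
      · ext w; simp [mem_outerBoundary]
      · rw [ih]
        congr 1
        ext u
        by_cases huw : u = w
        · subst huw; simp
        · simp [huw]
    · intro w hw w' hw' hne
      rw [Function.onFun, Finset.disjoint_left]
      intro ℓ' h h'
      simp only [Finset.mem_coe, Finset.mem_filter] at hw hw'
      -- The choice of `w'` gives it the label `i + 1`, while after the choice of `w` its final
      -- label is 0 or larger.
      have h1 := (growthCompletions_spec h w').2
        (by rw [Function.update_of_ne hne.symm]; exact hw'.2.1)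
      have h2 := (growthCompletions_spec h' w').1 (by simp)
      rw [Function.update_self] at h2
      omega

theorem growthState_of_mem_growthCompletions {n i : ℕ} {ℓ ℓ' : V → ℕ}
    (hℓ : GrowthState G i ℓ) (hn : (Finset.univ.filter (ℓ · = 0)).card = n)
    (h : ℓ' ∈ growthCompletions G n ℓ i) : (∃ j, GrowthState G j ℓ') ∧ ∀ u, ℓ' u ≠ 0 := by
  induction n generalizing ℓ i with
  | zero =>
    rw [growthCompletions, Finset.mem_singleton] at h
    subst h
    refine ⟨⟨i, hℓ⟩, fun u hu => ?_⟩
    rw [Finset.card_eq_zero] at hn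
    have : u ∈ Finset.univ.filter (ℓ' · = 0) := by simp [hu]
    rw [hn] at this
    simp at this
  | succ n ih =>
    rw [growthCompletions, Finset.mem_biUnion] at h
    obtain ⟨w, hw, h⟩ := h
    simp only [Finset.mem_filter] at hw
    obtain ⟨-, hw0, v, hv, hvw⟩ := hw
    refine ih (.step hℓ hv hvw hw0) ?_ h
    have : Finset.univ.filter (Function.update ℓ w (i + 1) · = 0) =
        (Finset.univ.filter (ℓ · = 0)).erase w := by
      ext u
      by_cases huw : u = w
      · subst huw; simp
      · simp [huw]
    rw [this, Finset.card_erase_of_mem (by simp [hw0]), hn]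
    rfl

/-- Completions of a state are among those of the preceding state. For a full labeling, its own only
completion, this traces the history back to the start. -/
theorem GrowthState.exists_start {i : ℕ} {ℓ : V → ℕ} (h : GrowthState G i ℓ) :
    ∀ ℓ' ∈ growthCompletions G (Finset.univ.filter (ℓ · = 0)).card ℓ i,
      ∃ v, ℓ' ∈ growthCompletions G (Fintype.card V - 1) (Pi.single v 1) 1 := by
  induction h with
  | start v =>
    intro ℓ' h
    refine ⟨v, ?_⟩
    have : Finset.univ.filter ((Pi.single v 1 : V → ℕ) · = 0) = Finset.univ.erase v := by
      ext u
      by_cases huv : u = v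
      · subst huv; simp
      · simp [huv]
    rwa [this, Finset.card_erase_of_mem (Finset.mem_univ v), Finset.card_univ] at h
  | @step v w i ℓ h hv hvw hw ih =>
    intro ℓ' h'
    apply ih
    have : Finset.univ.filter (Function.update ℓ w (i + 1) · = 0) =
        (Finset.univ.filter (ℓ · = 0)).erase w := by
      ext u
      by_cases huw : u = w
      · subst huw; simp
      · simp [huw]
    have hmem : w ∈ Finset.univ.filter (ℓ · = 0) := by simp [hw]
    have hcard := Finset.card_erase_add_one hmem
    rw [this] at h'
    rw [← hcard, growthCompletions, Finset.mem_biUnion]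
    exact ⟨w, by simpa [hw] using ⟨v, hv, hvw⟩, h'⟩

theorem numRandomWalkLabelings_eq_sum :
    numRandomWalkLabelings G = ∑ v, growthCount G (Fintype.card V - 1) {v} := by
  classical
  have hsupp (v : V) : Finset.univ.filter ((Pi.single v 1 : V → ℕ) · ≠ 0) = {v} := by
    ext u
    by_cases huv : u = v
    · subst huv; simp
    · simp [huv]
  have hset : {ℓ : V → ℕ | IsRandomWalkLabeling G ℓ} = ↑(Finset.univ.biUnion fun v : V =>
      growthCompletions G (Fintype.card V - 1) (Pi.single v 1) 1) := by
    ext ℓ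
    simp only [Set.mem_ofPred_eq, Finset.coe_biUnion, Set.mem_iUnion, Finset.mem_coe,
      Finset.mem_univ, exists_true_left, isRandomWalkLabeling_iff]
    constructor
    · rintro ⟨⟨i, h⟩, hne⟩
      refine h.exists_start ℓ ?_
      have : Finset.univ.filter (ℓ · = 0) = ∅ := by
        ext u; simp [hne u]
      rw [this, Finset.card_empty, growthCompletions, Finset.mem_singleton]
    · rintro ⟨v, h⟩
      refine growthState_of_mem_growthCompletions (.start v) ?_ h
      have : Finset.univ.filter ((Pi.single v 1 : V → ℕ) · = 0) = Finset.univ.erase v := by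
        ext u
        by_cases huv : u = v
        · subst huv; simp
        · simp [huv]
      rw [this, Finset.card_erase_of_mem (Finset.mem_univ v), Finset.card_univ]
  rw [numRandomWalkLabelings, hset, Set.ncard_coe_finset, Finset.card_biUnion]
  · simp only [card_growthCompletions, hsupp]
  · intro v _ v' _ hne
    rw [Function.onFun, Finset.disjoint_left]
    intro ℓ' h h'
    have h1 := (growthCompletions_spec h v').2 (Pi.single_eq_of_ne hne.symm _)
    have h2 := (growthCompletions_spec h' v').1 (by simp)
    rw [Pi.single_eq_same] at h2
    omega

end Growth

/-! ### Theta graphs. -/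

/-- `G` consists of two branch vertices `u` and `w` and of paths between them: the path `k` has `n k`
interior vertices and visits `Q k 0 = u, Q k 1, …, Q k (n k + 1) = w`. -/
structure IsThetaGraph {V ι : Type*} (G : SimpleGraph V) (n : ι → ℕ) (Q : ι → ℕ → V)
    (u w : V) : Prop where
  left (k : ι) : Q k 0 = u
  right (k : ι) : Q k (n k + 1) = w
  ne : u ≠ w
  surj (v : V) : ∃ k i, i ≤ n k + 1 ∧ Q k i = v
  inj {k k' : ι} {i i' : ℕ} (h1 : 1 ≤ i) (h2 : i ≤ n k) (h3 : i' ≤ n k' + 1)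
    (h : Q k i = Q k' i') : k = k' ∧ i = i'
  adj (a b : V) : G.Adj a b ↔
    ∃ k i, i ≤ n k ∧ (a = Q k i ∧ b = Q k (i + 1) ∨ b = Q k i ∧ a = Q k (i + 1))

namespace IsThetaGraph

section
variable {V ι : Type*} {G : SimpleGraph V} {n : ι → ℕ} {Q : ι → ℕ → V} {u w : V}

/-- The paths meet only at their ends. In this form, equality of vertices is reduced to arithmetic
of positions. -/
theorem eq_iff (h : IsThetaGraph G n Q u w) {k k' : ι} {i i' : ℕ} (hi : i ≤ n k + 1)
    (hi' : i' ≤ n k' + 1) :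
    Q k i = Q k' i' ↔ (k = k' ∧ i = i') ∨ (i = 0 ∧ i' = 0) ∨ (i = n k + 1 ∧ i' = n k' + 1) := by
  constructor
  · intro e
    by_cases h1 : 1 ≤ i ∧ i ≤ n k
    · exact .inl (h.inj h1.1 h1.2 hi' e)
    by_cases h2 : 1 ≤ i' ∧ i' ≤ n k'
    · obtain ⟨rfl, rfl⟩ := h.inj h2.1 h2.2 hi e.symm
      exact .inl ⟨rfl, rfl⟩
    have hne := h.ne
    obtain rfl | rfl : i = 0 ∨ i = n k + 1 := by omega
    · obtain rfl | rfl : i' = 0 ∨ i' = n k' + 1 := by omega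
      · simp
      · rw [h.left, h.right] at e; exact absurd e hne
    · obtain rfl | rfl : i' = 0 ∨ i' = n k' + 1 := by omega
      · rw [h.left, h.right] at e; exact absurd e.symm hne
      · simp
  · rintro (⟨rfl, rfl⟩ | ⟨rfl, rfl⟩ | ⟨rfl, rfl⟩)
    · rfl
    · rw [h.left, h.left]
    · rw [h.right, h.right]

/-- The same graph, with the paths read backwards. -/
theorem flip (h : IsThetaGraph G n Q u w) :
    IsThetaGraph G n (fun k i => Q k (n k + 1 - i)) w u where
  left k := by rw [Nat.sub_zero, h.right]
  right k := by rw [Nat.sub_self, h.left]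
  ne := h.ne.symm
  surj v := by
    obtain ⟨k, i, hi, rfl⟩ := h.surj v
    exact ⟨k, n k + 1 - i, by omega, by rw [Nat.sub_sub_self hi]⟩
  inj {k k' i i'} h1 h2 h3 e := by
    obtain ⟨rfl, e'⟩ := h.inj (by omega) (by omega) (by omega) e
    exact ⟨rfl, by omega⟩
  adj a b := by
    rw [h.adj]
    constructor
    · rintro ⟨k, i, hi, e⟩
      refine ⟨k, n k - i, by omega, ?_⟩
      rw [show n k + 1 - (n k - i) = i + 1 by omega, show n k + 1 - (n k - i + 1) = i by omega]
      tauto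
    · rintro ⟨k, i, hi, e⟩
      refine ⟨k, n k - i, by omega, ?_⟩
      rw [show n k - i + 1 = n k + 1 - i by omega, show n k - i = n k + 1 - (i + 1) by omega]
      tauto

theorem finset_ext (h : IsThetaGraph G n Q u w) {S S' : Finset V}
    (hS : ∀ k i, i ≤ n k + 1 → (Q k i ∈ S ↔ Q k i ∈ S')) : S = S' := by
  ext v
  obtain ⟨k, i, hi, rfl⟩ := h.surj v
  exact hS k i hi

theorem mem_outerBoundary_iff [Fintype V] [DecidableEq V] (h : IsThetaGraph G n Q u w)
    {S : Finset V} {v : V} :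
    v ∈ outerBoundary G S ↔ ∃ k j, j ≤ n k ∧
      (Q k j ∈ S ∧ Q k (j + 1) ∉ S ∧ v = Q k (j + 1) ∨
        Q k (j + 1) ∈ S ∧ Q k j ∉ S ∧ v = Q k j) := by
  rw [mem_outerBoundary]
  constructor
  · rintro ⟨hv, v', hv', hadj⟩
    obtain ⟨k, j, hj, ⟨rfl, rfl⟩ | ⟨rfl, rfl⟩⟩ := (h.adj _ _).1 hadj
    · exact ⟨k, j, hj, .inl ⟨hv', hv, rfl⟩⟩
    · exact ⟨k, j, hj, .inr ⟨hv', hv, rfl⟩⟩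
  · rintro ⟨k, j, hj, ⟨h1, h2, rfl⟩ | ⟨h1, h2, rfl⟩⟩
    · exact ⟨h2, _, h1, (h.adj _ _).2 ⟨k, j, hj, .inl ⟨rfl, rfl⟩⟩⟩
    · exact ⟨h2, _, h1, (h.adj _ _).2 ⟨k, j, hj, .inr ⟨rfl, rfl⟩⟩⟩

end

theorem sum_tsub_single {ι : Type*} [Fintype ι] {p : ι →₀ ℕ} {k : ι} (hk : p k ≠ 0) :
    ∑ j, (p - Finsupp.single k 1 : ι →₀ ℕ) j + 1 = ∑ j, p j := by
  classical
  have e : p = (p - Finsupp.single k 1) + Finsupp.single k 1 :=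
    (tsub_add_cancel_of_le (by rw [Finsupp.single_le_iff]; omega)).symm
  conv_rhs => rw [e]
  simp [Finset.sum_add_distrib, Finsupp.single_apply]

/-! ### Counting once a branch vertex is labeled. -/

section
variable {V ι : Type*} [Fintype V] [DecidableEq V] [Fintype ι]
  {G : SimpleGraph V} {n : ι → ℕ} {Q : ι → ℕ → V} {u w : V}

/-- The boundary consists of the ends of the gaps, and taking one shortens its gap: the recurrence
of `gapCount`. Here `l k` is the last labeled position before gap `k`. -/
theorem growthCount_gaps (h : IsThetaGraph G n Q u w) {l : ι → ℕ} {p : ι →₀ ℕ} {S : Finset V}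
    (hlp : ∀ k, l k + p k ≤ n k)
    (hS : ∀ k i, i ≤ n k + 1 → (Q k i ∈ S ↔ i ≤ l k ∨ l k + p k < i)) :
    (growthCount G (∑ k, p k) S : ℚ) = gapCount p := by
  classical
  induction hN : ∑ k, p k generalizing l p S with
  | zero =>
    have : p = 0 := by
      ext k
      exact Finset.sum_eq_zero_iff.1 hN k (Finset.mem_univ k)
    rw [this, gapCount_zero, growthCount, Nat.cast_one]
  | succ N ih =>
    have hp : p ≠ 0 := by rintro rfl; simp at hN
    set A := (Finset.univ.filter fun k => p k ≠ 0).image fun k => Q k (l k + 1) with hA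
    -- A gap of length 1 has only one end, already listed in `A`.
    set B := (Finset.univ.filter fun k => ¬ p k ≤ 1).image fun k => Q k (l k + p k) with hB
    have hbd : outerBoundary G S = A ∪ B := by
      ext v
      rw [h.mem_outerBoundary_iff, Finset.mem_union, hA, hB, Finset.mem_image, Finset.mem_image]
      simp only [Finset.mem_filter, Finset.mem_univ, true_and]
      constructor
      · rintro ⟨k, j, hj, ⟨h1, h2, rfl⟩ | ⟨h1, h2, rfl⟩⟩
        · rw [hS k _ (by omega)] at h1 h2
          exact .inl ⟨k, by omega, by rw [show j = l k by omega]⟩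
        · rw [hS k _ (by omega)] at h1 h2
          by_cases h3 : p k ≤ 1
          · exact .inl ⟨k, by omega, by rw [show l k + 1 = j by omega]⟩
          · exact .inr ⟨k, h3, by rw [show j = l k + p k by omega]⟩
      · rintro (⟨k, hk, rfl⟩ | ⟨k, hk, rfl⟩)
        · have := hlp k
          refine ⟨k, l k, by omega, .inl ⟨?_, ?_, rfl⟩⟩ <;> rw [hS k _ (by omega)] <;> omega
        · have := hlp k
          refine ⟨k, l k + p k, by omega, .inr ⟨?_, ?_, rfl⟩⟩ <;> rw [hS k _ (by omega)] <;> omega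
    have hdis : Disjoint A B := by
      rw [Finset.disjoint_left]
      intro v hv hv'
      rw [hA, Finset.mem_image] at hv
      rw [hB, Finset.mem_image] at hv'
      simp only [Finset.mem_filter, Finset.mem_univ, true_and] at hv hv'
      obtain ⟨k, hk, rfl⟩ := hv
      obtain ⟨k', hk', e⟩ := hv'
      have := hlp k
      have := hlp k'
      obtain ⟨rfl, e'⟩ := h.inj (by omega) (by omega) (by omega) e
      omega
    have hinsA (k : ι) (hk : p k ≠ 0) :
        (growthCount G N (insert (Q k (l k + 1)) S) : ℚ) = gapCount (p - Finsupp.single k 1) := by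
      have hl := hlp k
      have hsum := sum_tsub_single hk
      refine ih (l := Function.update l k (l k + 1)) (fun j => ?_) (fun j i hi => ?_) (by omega)
      · have := hlp j
        by_cases hj : j = k
        · subst hj; simp; omega
        · simp [Function.update_of_ne hj, Finsupp.single_eq_of_ne hj, this]
      · rw [Finset.mem_insert, hS j i hi, h.eq_iff hi (by omega)]
        by_cases hj : j = k
        · subst hj
          simp only [Function.update_self, Finsupp.tsub_apply, Finsupp.single_eq_same, true_and]
          omega
        · simp only [Function.update_of_ne hj, Finsupp.tsub_apply, Finsupp.single_eq_of_ne hj, hj, false_and, false_or]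
          omega
    have hinsB (k : ι) (hk : ¬ p k ≤ 1) :
        (growthCount G N (insert (Q k (l k + p k)) S) : ℚ) =
          gapCount (p - Finsupp.single k 1) := by
      have hl := hlp k
      have hsum := sum_tsub_single (p := p) (k := k) (by omega)
      refine ih (l := l) (fun j => ?_) (fun j i hi => ?_) (by omega)
      · have := hlp j
        rw [Finsupp.tsub_apply]; omega
      · rw [Finset.mem_insert, hS j i hi, h.eq_iff hi (by omega)]
        by_cases hj : j = k
        · subst hj
          simp only [Finsupp.tsub_apply, Finsupp.single_eq_same, true_and]
          omega
        · simp only [Finsupp.tsub_apply, Finsupp.single_eq_of_ne hj, hj, false_and, false_or]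
          omega
    rw [growthCount, hbd, Finset.sum_union hdis, hA, hB, Finset.sum_image, Finset.sum_image,
      Finset.sum_filter, Finset.sum_filter, gapCount_rec hp]
    · push_cast
      congr 1
      · refine Finset.sum_congr rfl fun k _ => ?_
        by_cases hk : p k = 0
        · simp [hk]
        · rw [if_pos hk, if_neg hk, hinsA k hk]
      · refine Finset.sum_congr rfl fun k _ => ?_
        by_cases hk : p k ≤ 1
        · simp [hk]
        · rw [if_pos hk, if_neg hk, hinsB k hk]
    · intro k hk k' hk' e
      simp only [Finset.coe_filter, Finset.mem_univ, true_and] at hk hk'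
      change ¬ p k ≤ 1 at hk
      change ¬ p k' ≤ 1 at hk'
      have := hlp k
      have := hlp k'
      exact (h.inj (by omega) (by omega) (by omega) e).1
    · intro k hk k' hk' e
      simp only [Finset.coe_filter, Finset.mem_univ, true_and] at hk hk'
      change p k ≠ 0 at hk
      change p k' ≠ 0 at hk'
      have := hlp k
      have := hlp k'
      exact (h.inj (by omega) (by omega) (by omega) e).1

end

section
variable {V : Type*} [Fintype V] [DecidableEq V]
  {G : SimpleGraph V} {n : Fin 3 → ℕ} {Q : Fin 3 → ℕ → V} {u w : V}

/-- The next vertex prolongs one of the three arms or, once some path is exhausted, is `w`, after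
which only gaps remain. The additional 1 in the number of steps is for `w`. -/
theorem growthCount_tree (h : IsThetaGraph G n Q u w) {l : Fin 3 → ℕ} {p : Fin 3 →₀ ℕ}
    {S : Finset V} (hlp : ∀ k, l k + p k = n k)
    (hS : ∀ k i, i ≤ n k + 1 → (Q k i ∈ S ↔ i ≤ l k)) :
    (growthCount G (∑ k, p k + 1) S : ℚ) = coeff p treeSeries := by
  classical
  induction hN : ∑ k, p k using Nat.strong_induction_on generalizing l p S with
  | _ N ih =>
    set A := (Finset.univ.filter fun k => p k ≠ 0).image fun k => Q k (l k + 1) with hA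
    -- However many paths are exhausted, `w` is one candidate: hence a condition, not a sum over
    -- `k`.
    set B : Finset V := if ∃ k, p k = 0 then {w} else ∅ with hB
    have hbd : outerBoundary G S = A ∪ B := by
      ext v
      rw [h.mem_outerBoundary_iff, Finset.mem_union, hA, hB, Finset.mem_image]
      simp only [Finset.mem_filter, Finset.mem_univ, true_and]
      constructor
      · rintro ⟨k, j, hj, ⟨h1, h2, rfl⟩ | ⟨h1, h2, rfl⟩⟩
        · rw [hS k _ (by omega)] at h1 h2
          have := hlp k
          by_cases h3 : p k = 0
          · right
            rw [if_pos ⟨k, h3⟩, Finset.mem_singleton, ← h.right k,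
              show n k + 1 = j + 1 by omega]
          · exact .inl ⟨k, h3, by rw [show j = l k by omega]⟩
        · rw [hS k _ (by omega)] at h1 h2
          omega
      · rintro (⟨k, hk, rfl⟩ | hv)
        · have := hlp k
          refine ⟨k, l k, by omega, .inl ⟨?_, ?_, rfl⟩⟩
          · rw [hS k _ (by omega)]
          · rw [hS k _ (by omega)]; omega
        · by_cases h3 : ∃ k, p k = 0
          · rw [if_pos h3, Finset.mem_singleton] at hv
            obtain ⟨k, hk⟩ := h3
            have := hlp k
            rw [hv, ← h.right k]
            exact ⟨k, n k, le_rfl, .inl ⟨(hS k _ (by omega)).2 (by omega),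
              fun h' => by rw [hS k _ le_rfl] at h'; omega, rfl⟩⟩
          · rw [if_neg h3] at hv
            simp at hv
    have hdis : Disjoint A B := by
      rw [Finset.disjoint_left]
      intro v hv hv'
      rw [hA, Finset.mem_image] at hv
      simp only [Finset.mem_filter, Finset.mem_univ, true_and] at hv
      obtain ⟨k, hk, rfl⟩ := hv
      have := hlp k
      have : Q k (l k + 1) = w := by
        rw [hB] at hv'
        split_ifs at hv' with h3
        · exact Finset.mem_singleton.1 hv'
        · simp at hv'
      rw [← h.right k] at this
      have := (h.inj (by omega) (by omega) (by omega) this).2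
      omega
    have hinsA (k : Fin 3) (hk : p k ≠ 0) :
        (growthCount G N (insert (Q k (l k + 1)) S) : ℚ) =
          coeff (p - Finsupp.single k 1) treeSeries := by
      have hl := hlp k
      have hsum := sum_tsub_single hk
      obtain ⟨M, rfl⟩ : ∃ M, N = M + 1 := ⟨_, (hN.symm.trans hsum.symm)⟩
      refine ih M (by omega) (l := Function.update l k (l k + 1)) (fun j => ?_)
        (fun j i hi => ?_) (by omega)
      · have := hlp j
        by_cases hj : j = k
        · subst hj; simp; omega
        · simp [Function.update_of_ne hj, Finsupp.single_eq_of_ne hj, this]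
      · rw [Finset.mem_insert, hS j i hi, h.eq_iff hi (by omega)]
        by_cases hj : j = k
        · subst hj
          simp only [Function.update_self, true_and]
          omega
        · simp only [Function.update_of_ne hj, hj, false_and, false_or]
          omega
    have hinsB : (growthCount G N (insert w S) : ℚ) = gapCount p := by
      rw [← hN]
      refine h.growthCount_gaps (l := l) (fun k => (hlp k).le) fun k i hi => ?_
      have := hlp k
      rw [Finset.mem_insert, hS k i hi, ← h.right k, h.eq_iff hi le_rfl]
      omega
    rw [growthCount, hbd, Finset.sum_union hdis, hA, Finset.sum_image,
      Finset.sum_filter, coeff_treeSeries]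
    · push_cast
      congr 1
      · refine Finset.sum_congr rfl fun k _ => ?_
        by_cases hk : p k = 0
        · simp [hk]
        · rw [if_pos hk, if_neg hk, hinsA k hk]
      · rw [hB]
        split_ifs with h3
        · rw [Finset.sum_singleton, hinsB]
        · simp
    · intro k hk k' hk' e
      simp only [Finset.coe_filter, Finset.mem_univ, true_and] at hk hk'
      change p k ≠ 0 at hk
      change p k' ≠ 0 at hk'
      have := hlp k
      have := hlp k'
      exact (h.inj (by omega) (by omega) (by omega) e).1

end

end IsThetaGraph

/-! ### Intervals inside one path, and the total count. -/

namespace IsThetaGraph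
variable {V : Type*} [DecidableEq V]

/-- The vertices of the path `k` without the first `s` and the last `j` interior vertices (and
without the branch vertices). -/
def pathInterval {ι : Type*} (n : ι → ℕ) (Q : ι → ℕ → V) (k : ι) (s j : ℕ) : Finset V :=
  (Finset.Icc (s + 1) (n k - j)).image (Q k)

section
variable {ι : Type*} {G : SimpleGraph V} {n : ι → ℕ} {Q : ι → ℕ → V} {u w : V}

theorem mem_pathInterval (h : IsThetaGraph G n Q u w) (k : ι) (s j : ℕ) {k' : ι} {i : ℕ}
    (hi : i ≤ n k' + 1) : Q k' i ∈ pathInterval n Q k s j ↔ k' = k ∧ s < i ∧ i + j ≤ n k := by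
  rw [pathInterval, Finset.mem_image]
  constructor
  · rintro ⟨i', hi', e⟩
    rw [Finset.mem_Icc] at hi'
    obtain ⟨rfl, rfl⟩ := h.inj (by omega) (by omega) hi e
    exact ⟨rfl, by omega, by omega⟩
  · rintro ⟨rfl, h1, h2⟩
    exact ⟨i, by rw [Finset.mem_Icc]; omega, rfl⟩

/-- Reversal derives the right-hand statements below from their left-hand twins. -/
theorem pathInterval_flip (h : IsThetaGraph G n Q u w) (k : ι) (s j : ℕ) :
    pathInterval n (fun k i => Q k (n k + 1 - i)) k s j = pathInterval n Q k j s := by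
  refine h.finset_ext fun k' i hi => ?_
  rw [h.mem_pathInterval k j s hi]
  have := h.flip.mem_pathInterval k s j (k' := k') (i := n k' + 1 - i) (by omega)
  rw [Nat.sub_sub_self hi] at this
  rw [this]
  refine and_congr_right ?_
  rintro rfl
  omega

theorem insert_pathInterval (h : IsThetaGraph G n Q u w) {k : ι} {s j : ℕ}
    (hsj : s + 1 + j < n k) :
    insert (Q k (s + 1)) (pathInterval n Q k (s + 1) j) = pathInterval n Q k s j := by
  refine h.finset_ext fun k' i hi => ?_
  rw [Finset.mem_insert, h.mem_pathInterval _ _ _ hi, h.mem_pathInterval _ _ _ hi,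
    h.eq_iff hi (by omega)]
  by_cases hk : k' = k
  · subst hk
    simp only [true_and]
    omega
  · simp only [hk, false_and, false_or, or_false, iff_false]
    omega

theorem insert_pathInterval_right (h : IsThetaGraph G n Q u w) {k : ι} {s j : ℕ}
    (hsj : s + (j + 1) < n k) :
    insert (Q k (n k + 1 - (j + 1))) (pathInterval n Q k s (j + 1)) = pathInterval n Q k s j := by
  have := h.flip.insert_pathInterval (k := k) (s := j) (j := s) (by omega)
  rwa [h.pathInterval_flip, h.pathInterval_flip] at this

theorem outerBoundary_pathInterval [Fintype V] (h : IsThetaGraph G n Q u w) {k : ι} {s j : ℕ}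
    (hsj : s + j < n k) :
    outerBoundary G (pathInterval n Q k s j) = {Q k s, Q k (n k + 1 - j)} := by
  ext v
  rw [h.mem_outerBoundary_iff, Finset.mem_insert, Finset.mem_singleton]
  constructor
  · rintro ⟨k', i, hi, ⟨h1, h2, rfl⟩ | ⟨h1, h2, rfl⟩⟩
    · rw [h.mem_pathInterval _ _ _ (by omega)] at h1 h2
      obtain ⟨rfl, h1⟩ := h1
      right
      congr 1
      by_contra hne
      exact h2 ⟨rfl, by omega, by omega⟩
    · rw [h.mem_pathInterval _ _ _ (by omega)] at h1 h2
      obtain ⟨rfl, h1⟩ := h1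
      left
      congr 1
      by_contra hne
      exact h2 ⟨rfl, by omega, by omega⟩
  · rintro (rfl | rfl)
    · refine ⟨k, s, by omega, .inr ⟨?_, ?_, rfl⟩⟩ <;> rw [h.mem_pathInterval _ _ _ (by omega)]
      · exact ⟨rfl, by omega, by omega⟩
      · rintro ⟨-, h1, -⟩; omega
    · refine ⟨k, n k - j, by omega, .inl ⟨?_, ?_, by congr 1; omega⟩⟩ <;>
        rw [h.mem_pathInterval _ _ _ (by omega)]
      · exact ⟨rfl, by omega, by omega⟩
      · rintro ⟨-, -, h1⟩; omega

end

section
variable [Fintype V] {G : SimpleGraph V} {n : Fin 3 → ℕ} {Q : Fin 3 → ℕ → V} {u w : V}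

theorem growthCount_insert_left (h : IsThetaGraph G n Q u w) {k : Fin 3} {p : Fin 3 →₀ ℕ}
    (hp : ∀ k' ≠ k, p k' = n k') (hk : p k < n k) :
    (growthCount G (∑ k, p k + 1) (insert (Q k 0) (pathInterval n Q k 0 (p k))) : ℚ) =
      coeff p treeSeries := by
  refine h.growthCount_tree (l := fun k' => if k' = k then n k - p k else 0)
    (fun k' => ?_) fun k' i hi => ?_
  · by_cases hk' : k' = k
    · subst hk'; simp; omega
    · simp [hk', hp k' hk']
  · rw [Finset.mem_insert, h.mem_pathInterval _ _ _ hi, h.eq_iff hi (by omega)]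
    by_cases hk' : k' = k
    · subst hk'; simp only [true_and, if_true]; omega
    · simp only [hk', false_and, or_false, false_or, if_false, and_true]; omega

theorem growthCount_insert_right (h : IsThetaGraph G n Q u w) {k : Fin 3} {p : Fin 3 →₀ ℕ}
    (hp : ∀ k' ≠ k, p k' = n k') (hk : p k < n k) :
    (growthCount G (∑ k, p k + 1) (insert (Q k (n k + 1)) (pathInterval n Q k (p k) 0)) : ℚ) =
      coeff p treeSeries := by
  have := h.flip.growthCount_insert_left hp hk
  rwa [h.pathInterval_flip, Nat.sub_zero] at this

/-- A single position has no closed recurrence, but the sum over positions does: extending left or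
right maps onto all positions of the longer interval, except that an extreme position yields a
branch vertex and so a tree. The 2 counts both branch vertices. -/
theorem sum_growthCount_pathInterval (h : IsThetaGraph G n Q u w) {k : Fin 3} {p : Fin 3 →₀ ℕ}
    (hp : ∀ k' ≠ k, p k' = n k') (hk : p k < n k) :
    ∑ q ∈ Finset.HasAntidiagonal.antidiagonal (p k),
      (growthCount G (∑ k, p k + 2) (pathInterval n Q k q.1 q.2) : ℚ) =
        coeff p (intervalSeries k) := by
  have hstep (N : ℕ) {s j : ℕ} (hsj : s + j < n k) :
      (growthCount G (N + 2) (pathInterval n Q k s j) : ℚ) =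
        growthCount G (N + 1) (insert (Q k s) (pathInterval n Q k s j))
        + growthCount G (N + 1) (insert (Q k (n k + 1 - j)) (pathInterval n Q k s j)) := by
    rw [growthCount, h.outerBoundary_pathInterval hsj, Finset.sum_pair]
    · push_cast; rfl
    · intro e
      rw [h.eq_iff (by omega) (by omega)] at e
      omega
  induction hm : p k generalizing p with
  | zero =>
    have hl := h.growthCount_insert_left hp hk
    have hr := h.growthCount_insert_right hp hk
    rw [hm] at hl hr
    rw [Finset.Nat.antidiagonal_zero, Finset.sum_singleton, hstep _ (by omega), Nat.sub_zero, hl, hr,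
      coeff_intervalSeries, if_pos hm, zero_add, two_mul]
  | succ m ih =>
    have hl := h.growthCount_insert_left hp hk
    have hr := h.growthCount_insert_right hp hk
    rw [hm] at hl hr
    have hsum := sum_tsub_single (p := p) (k := k) (by omega)
    have ih' := ih (p := p - Finsupp.single k 1)
      (fun k' hk' => by simp [Finsupp.single_eq_of_ne hk', hp k' hk'])
      (by simp only [Finsupp.tsub_apply, Finsupp.single_eq_same]; omega)
      (by simp only [Finsupp.tsub_apply, Finsupp.single_eq_same]; omega)
    have hsplit : ∑ q ∈ Finset.HasAntidiagonal.antidiagonal (m + 1),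
        (growthCount G (∑ k, p k + 2) (pathInterval n Q k q.1 q.2) : ℚ) =
        ∑ q ∈ Finset.HasAntidiagonal.antidiagonal (m + 1), (growthCount G (∑ k, p k + 1)
          (insert (Q k q.1) (pathInterval n Q k q.1 q.2)) : ℚ)
        + ∑ q ∈ Finset.HasAntidiagonal.antidiagonal (m + 1), (growthCount G (∑ k, p k + 1)
          (insert (Q k (n k + 1 - q.2)) (pathInterval n Q k q.1 q.2)) : ℚ) := by
      rw [← Finset.sum_add_distrib]
      refine Finset.sum_congr rfl fun q hq => ?_
      rw [Finset.HasAntidiagonal.mem_antidiagonal] at hq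
      exact hstep _ (by omega)
    -- The terms `q.1 = 0` and `q.2 = 0` that are split off are the two where a branch vertex is
    -- taken.
    rw [hsplit, Finset.Nat.sum_antidiagonal_succ, Finset.Nat.sum_antidiagonal_succ', hl,
      Nat.sub_zero, hr, coeff_intervalSeries, if_neg (by omega), ← ih']
    have e1 : ∑ q ∈ Finset.HasAntidiagonal.antidiagonal m, (growthCount G (∑ k, p k + 1)
          (insert (Q k (q.1 + 1)) (pathInterval n Q k (q.1 + 1) q.2)) : ℚ) =
        ∑ q ∈ Finset.HasAntidiagonal.antidiagonal m, (growthCount G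
          (∑ j, (p - Finsupp.single k 1 : Fin 3 →₀ ℕ) j + 2) (pathInterval n Q k q.1 q.2) : ℚ) := by
      refine Finset.sum_congr rfl fun q hq => ?_
      rw [Finset.HasAntidiagonal.mem_antidiagonal] at hq
      rw [h.insert_pathInterval (by omega), ← hsum]
    have e2 : ∑ q ∈ Finset.HasAntidiagonal.antidiagonal m, (growthCount G (∑ k, p k + 1)
          (insert (Q k (n k + 1 - (q.2 + 1))) (pathInterval n Q k q.1 (q.2 + 1))) : ℚ) =
        ∑ q ∈ Finset.HasAntidiagonal.antidiagonal m, (growthCount G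
          (∑ j, (p - Finsupp.single k 1 : Fin 3 →₀ ℕ) j + 2) (pathInterval n Q k q.1 q.2) : ℚ) := by
      refine Finset.sum_congr rfl fun q hq => ?_
      rw [Finset.HasAntidiagonal.mem_antidiagonal] at hq
      rw [h.insert_pathInterval_right (by omega), ← hsum]
    rw [e1, e2]
    ring

theorem sum_vertices (h : IsThetaGraph G n Q u w) {M : Type*} [AddCommMonoid M] (f : V → M) :
    ∑ v, f v = f u + (f w + ∑ k, ∑ i ∈ Finset.range (n k), f (Q k (i + 1))) := by
  rw [Finset.sum_sigma']
  set A := (Finset.univ.sigma fun k => Finset.range (n k)).image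
    (fun x : (_ : Fin 3) × ℕ => Q x.1 (x.2 + 1)) with hA
  have hAmem (v : V) : v ∈ A ↔ ∃ k i, i < n k ∧ Q k (i + 1) = v := by
    rw [hA, Finset.mem_image]
    constructor
    · rintro ⟨x, hx, rfl⟩
      exact ⟨x.1, x.2, by simpa using hx, rfl⟩
    · rintro ⟨k, i, hi, rfl⟩
      exact ⟨⟨k, i⟩, by simpa using hi, rfl⟩
  have hw : w ∉ A := by
    rw [hAmem]
    rintro ⟨k, i, hi, e⟩
    rw [← h.right k, h.eq_iff (by omega) le_rfl] at e
    omega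
  have hu : u ∉ insert w A := by
    rw [Finset.mem_insert, hAmem, not_or]
    refine ⟨h.ne, ?_⟩
    rintro ⟨k, i, hi, e⟩
    rw [← h.left k, h.eq_iff (by omega) (by omega)] at e
    omega
  have huniv : Finset.univ = insert u (insert w A) := by
    ext v
    simp only [Finset.mem_univ, Finset.mem_insert, true_iff]
    obtain ⟨k, i, hi, rfl⟩ := h.surj v
    by_cases h0 : i = 0
    · left; rw [h0, h.left]
    by_cases h1 : i = n k + 1
    · right; left; rw [h1, h.right]
    · right; right
      rw [hAmem]
      exact ⟨k, i - 1, by omega, by congr 1; omega⟩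
  rw [huniv, Finset.sum_insert hu, Finset.sum_insert hw, hA, Finset.sum_image]
  rintro ⟨k, i⟩ hx ⟨k', i'⟩ hx' e
  replace hx : i < n k := by simpa using hx
  replace hx' : i' < n k' := by simpa using hx'
  obtain ⟨rfl, e'⟩ := h.inj (i := i + 1) (i' := i' + 1) (k := k) (k' := k')
    (by omega) (by omega) (by omega) e
  obtain rfl : i = i' := by omega
  rfl

theorem card_vertices (h : IsThetaGraph G n Q u w) : Fintype.card V = ∑ k, n k + 2 := by
  have := h.sum_vertices (fun _ => 1)
  simp only [Finset.sum_const, Finset.card_univ, Finset.card_range, smul_eq_mul, mul_one] at this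
  omega

/-- A start at a branch vertex is a tree with empty arms; a start inside path `k` is an interval of
one vertex, which uses up one vertex of that path and explains the factor `X k`. -/
theorem numRandomWalkLabelings_eq (h : IsThetaGraph G n Q u w) {p : Fin 3 →₀ ℕ}
    (hp : ∀ k, p k = n k) : (numRandomWalkLabelings G : ℚ) = coeff p thetaSeries := by
  rw [numRandomWalkLabelings_eq_sum, h.card_vertices, h.sum_vertices,
    show ∑ k, n k + 2 - 1 = ∑ k, p k + 1 by simp [hp]]
  have hu : (growthCount G (∑ k, p k + 1) {u} : ℚ) = coeff p treeSeries := by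
    refine h.growthCount_tree (l := 0) (fun k => by simp [hp]) fun k i hi => ?_
    rw [Finset.mem_singleton, ← h.left k, h.eq_iff hi (by omega)]
    simp
  have hw : (growthCount G (∑ k, p k + 1) {w} : ℚ) = coeff p treeSeries := by
    refine h.flip.growthCount_tree (l := 0) (fun k => by simp [hp]) fun k i hi => ?_
    rw [Finset.mem_singleton, ← h.right k, h.eq_iff (by omega) le_rfl]
    simp only [Pi.zero_apply, true_and]
    omega
  have hk (k : Fin 3) : ∑ i ∈ Finset.range (n k),
      (growthCount G (∑ k, p k + 1) {Q k (i + 1)} : ℚ) = coeff p (X k * intervalSeries k) := by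
    rw [coeff_X_mul_eq]
    split_ifs with h0
    · rw [← hp k, h0]; simp
    · have hsum := sum_tsub_single (p := p) (k := k) h0
      have := h.sum_growthCount_pathInterval (k := k) (p := p - Finsupp.single k 1)
        (fun k' hk' => by simp [Finsupp.single_eq_of_ne hk', hp k'])
        (by have := hp k; simp only [Finsupp.tsub_apply, Finsupp.single_eq_same]; omega)
      rw [← this, Finsupp.tsub_apply, Finsupp.single_eq_same,
        Finset.Nat.sum_antidiagonal_eq_sum_range_succ_mk, hp k]
      have hn := hp k
      rw [show (n k - 1).succ = n k by omega]
      refine Finset.sum_congr rfl fun i hi => ?_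
      rw [Finset.mem_range] at hi
      rw [← hsum]
      congr 2
      refine h.finset_ext fun k' i' hi' => ?_
      rw [Finset.mem_singleton, h.mem_pathInterval _ _ _ hi', h.eq_iff hi' (by omega)]
      by_cases hk' : k' = k
      · subst hk'; simp only [true_and]; omega
      · simp only [hk', false_and, false_or, iff_false]; omega
  push_cast
  rw [hu, hw, Finset.sum_congr rfl fun k _ => hk k, thetaSeries, map_add, map_sum, two_mul,
    map_add, add_assoc]

end

end IsThetaGraph

/-! ### The graph $S$ as a theta graph. -/

section
variable {a₁ a₂ a₃ : ℕ}

/-- The walks along the three paths of `S_{a₁,a₂,a₃}` that lead from the first to the last vertex of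
the middle path. -/
def threePathsWalk (h : 2 ≤ a₂) : Fin 3 → ℕ → Fin a₁ ⊕ Fin a₂ ⊕ Fin a₃
  | 0, i => if i = 0 then .inr (.inl ⟨0, by omega⟩) else
      if hi : i - 1 < a₁ then .inl ⟨i - 1, hi⟩ else .inr (.inl ⟨a₂ - 1, by omega⟩)
  | 1, i => .inr (.inl ⟨min i (a₂ - 1), by omega⟩)
  | 2, i => if i = 0 then .inr (.inl ⟨0, by omega⟩) else
      if hi : i - 1 < a₃ then .inr (.inr ⟨i - 1, hi⟩) else .inr (.inl ⟨a₂ - 1, by omega⟩)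

theorem threePathsGraph_isThetaGraph (h₁ : 2 ≤ a₁) (h₂ : 2 ≤ a₂) (h₃ : 2 ≤ a₃) :
    IsThetaGraph (threePathsGraph a₁ a₂ a₃) ![a₁, a₂ - 2, a₃] (threePathsWalk h₂)
      (.inr (.inl ⟨0, by omega⟩)) (.inr (.inl ⟨a₂ - 1, by omega⟩)) where
  left k := by fin_cases k <;> simp [threePathsWalk]
  right k := by fin_cases k <;> simp [threePathsWalk]; omega
  ne := by simp; omega
  surj v := by
    rcases v with ⟨i, hi⟩ | ⟨i, hi⟩ | ⟨i, hi⟩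
    · exact ⟨0, i + 1, by simp; omega, by simp [threePathsWalk, hi]⟩
    · exact ⟨1, i, by simp; omega, by simp [threePathsWalk]; omega⟩
    · exact ⟨2, i + 1, by simp; omega, by simp [threePathsWalk, hi]⟩
  inj {k k' i i'} p1 p2 p3 e := by
    fin_cases k <;> fin_cases k' <;> simp [threePathsWalk] at p2 p3 e ⊢ <;>
      (try split_ifs at e) <;> (try simp at e) <;> omega
  adj a b := by
    rw [threePathsGraph, SimpleGraph.fromRel_adj]
    constructor
    · rintro ⟨hne, hab⟩
      wlog hr : threePathsRel a₁ a₂ a₃ a b generalizing a b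
      · obtain ⟨k, i, hi, e⟩ := this b a hne.symm hab.symm (hab.resolve_left hr)
        exact ⟨k, i, hi, e.symm⟩
      clear hab
      rcases a with ⟨i, hi⟩ | ⟨i, hi⟩ | ⟨i, hi⟩ <;> rcases b with ⟨j, hj⟩ | ⟨j, hj⟩ | ⟨j, hj⟩ <;>
        simp only [threePathsRel] at hr
      · subst hr
        exact ⟨0, i + 1, by simp; omega, .inl ⟨by simp [threePathsWalk, hi],
          by simp [threePathsWalk, hj]⟩⟩
      · obtain ⟨rfl, rfl⟩ | ⟨rfl, e⟩ := hr
        · exact ⟨0, 0, by simp, .inr ⟨by simp [threePathsWalk], by simp [threePathsWalk, hi]⟩⟩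
        · exact ⟨0, i + 1, by simp, .inl ⟨by simp [threePathsWalk],
            by simp [threePathsWalk]; omega⟩⟩
      · subst hr
        exact ⟨1, i, by simp; omega, .inl ⟨by simp [threePathsWalk]; omega,
          by simp [threePathsWalk]; omega⟩⟩
      · obtain ⟨rfl, rfl⟩ | ⟨rfl, e⟩ := hr
        · exact ⟨2, 0, by simp, .inr ⟨by simp [threePathsWalk], by simp [threePathsWalk, hi]⟩⟩
        · exact ⟨2, i + 1, by simp, .inl ⟨by simp [threePathsWalk],
            by simp [threePathsWalk]; omega⟩⟩
      · subst hr
        exact ⟨2, i + 1, by simp; omega, .inl ⟨by simp [threePathsWalk, hi],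
          by simp [threePathsWalk, hj]⟩⟩
    · rintro ⟨k, i, hi, e⟩
      wlog hr : a = threePathsWalk h₂ k i ∧ b = threePathsWalk h₂ k (i + 1) generalizing a b
      · obtain ⟨h1, h2⟩ := this b a e.symm (e.resolve_left hr)
        exact ⟨h1.symm, h2.symm⟩
      obtain ⟨rfl, rfl⟩ := hr
      clear e
      fin_cases k <;> simp [threePathsWalk] at hi ⊢ <;> (try split_ifs) <;>
        simp [threePathsRel] <;> omega
end

theorem mainTheorem5 (x y z : MvPowerSeries (Fin 3) ℚ)
    (hx : x = MvPowerSeries.X 0) (hy : y = MvPowerSeries.X 1) (hz : z = MvPowerSeries.X 2) :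
    MvPowerSeries.constantCoeff (threePathsDenominator x y z) = 1 ∧
    threePathsGenFun =
      16 * x ^ 2 * y ^ 2 * z ^ 2 * threePathsNumerator x y z * (threePathsDenominator x y z)⁻¹ := by
  constructor
  · simp [threePathsDenominator, hx, hy, hz]
  · refine threePaths_series_eq hx hy hz (fun a h0 h1 h2 => ?_) fun a => rfl
    -- The shift of the middle exponent by 2 matches the `a 1 - 2` interior vertices of the middle
    -- path.
    refine (threePathsGraph_isThetaGraph h0 h1 h2).numRandomWalkLabelings_eq fun k => ?_
    fin_cases k <;> simp
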